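/- Conventions. A schema $\mathbf S$ is a finite set of relation symbols with arities $\ge 0$. An $\mathbf S$-instance is a set of facts $R(a_1,\dots,a_n)$, $R\in\mathbf S$; it is finite unless said otherwise. Its active domain $\mathrm{adom}(I)$ is the set of values occurring in its facts. A homomorphism $I\to J$ is a map $\mathrm{adom}(I)\to\mathrm{adom}(J)$ that sends facts of $I$ to facts of $J$. A $k$-ary pointed instance $(I,\mathbf a)$ is a finite instance $I$ with $\mathbf a\in\mathrm{adom}(I)^k$; homomorphisms $(I,\mathbf a)\to(J,\mathbf b)$ must map $\mathbf a$ to $\mathbf b$. $(I,\mathbf a)$ is *c-acyclic* if every cycle of the incidence multigraph of $I$ (vertices: elements and facts; one edge for each occurrence of an element in a fact) contains an element of $\mathbf a$. A TGD is a sentence $\forall\mathbf x(\phi(\mathbf x)\to\exists\mathbf y\,\psi(\mathbf x,\mathbf y))$ with $\phi,\psi$ conjunctions of relational atoms, where $\mathbf x$ are the variables of $\phi$. An existential Datalog program $P$ has disjoint input, output and auxiliary schemas and a set of rules $\exists\mathbf y\,\psi(\mathbf x,\mathbf y)\,{:\!-}\,\phi(\mathbf x)$ whose bodies use input and auxiliary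 relations and whose heads use output and auxiliary relations. A solution for a (possibly infinite) input instance $I$ is a (possibly infinite) instance $J\supseteq I$ over the union of the three schemas in which all rules hold; it is universal if for every solution $J'$ for $I$ there is a homomorphism $J\to J'$ that is the identity on $\mathrm{adom}(I)$. $P(I)$ denotes the output reduct of an arbitrary universal solution for $I$. For a set $\Sigma$ of TGDs over $\mathbf S$, the program $P_\Sigma$ has input schema $\{R_{in}\mid R\in\mathbf S\}$, output schema $\{R_{out}\mid R\in\mathbf S\}$ and auxiliary schema $\mathbf S$; its rules are the TGDs of $\Sigma$ and the copy rules $R(\mathbf x)\,{:\!-}\,R_{in}(\mathbf x)$ and $R_{out}(\mathbf x)\,{:\!-}\,R(\mathbf x)$, $R\in\mathbf S$. Its input and output instances are identified with $\mathbf S$-instances. $P$ is *weakly acyclic* if no directed cycle of the following graph goes through a special edge. The nodes are the positions $(R,i)$ of auxiliary relations. There is a normal edge $(R,i)\to(S,j)$ if, in some rule, a variable occurs in position $i$ of an $R$-atom of the body and in position $j$ of an $S$-atom of the head; there is a special edge $(R,i)\to(S,j)$ if, in some rule, $R$ occurs in the body and the head has an $S$-atom with an existential variable in position $j$. A *generalized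 right-adjoint* for $P$ is a function $\Omega$ that maps every finite output instance $J$ to a finite set of pairs $(J',\iota)$, with $J'$ a finite input instance and $\iota$ a partial function from $\mathrm{adom}(J')$ to $\mathrm{adom}(J)$, such that for all finite or infinite input instances $I$: for every homomorphism $h:P(I)\to J$ there are $(J',\iota)\in\Omega(J)$ and a homomorphism $g:I\to J'$ with $\iota(g(a))=h(a)$ for all $a\in\mathrm{adom}(I)\cap\mathrm{adom}(P(I))$; and for every $(J',\iota)\in\Omega(J)$ and every homomorphism $g:I\to J'$ there is a homomorphism $h:P(I)\to J$ with the same property. Theorem. Let $\Sigma$ be a finite set of TGDs over a schema $\mathbf S$ such that $P_\Sigma$ is weakly acyclic and has a generalized right-adjoint, and let $k\ge 0$. Let $F$ be a finite set of $k$-ary pointed $\mathbf S$-instances, each of the form $(P_\Sigma(A),\mathbf a)$ for some c-acyclic pointed instance $(A,\mathbf a)$. Then $F$ has finite duality with respect to $\Sigma$: there is a finite set $D$ of $k$-ary pointed $\mathbf S$-instances $(B,\mathbf b)$ with $B\models\Sigma$ such that, for every $k$-ary pointed $\mathbf S$-instance $(C,\mathbf c)$ with $C\models\Sigma$, some member of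 $F$ maps homomorphically to $(C,\mathbf c)$ if and only if $(C,\mathbf c)$ maps homomorphically to no member of $D$. -/

import Mathlib

namespace HomDuality

/-! ### Schemas, facts, instances, homomorphisms -/

/-- A schema: finitely many relation symbols, each with an arity (possibly zero). -/
structure Schema where
  Rel : Type
  arity : Rel → ℕ
  finite : Finite Rel

/-- A relational atom `R(v₁, …, vₙ)` over a set `V`. When `V` is a set of values, this is a fact;
when `V` is a set of variables, it is an atomic formula. -/
structure Atom (S : Schema) (V : Type) where
  rel : S.Rel
  args : Fin (S.arity rel) → V

/-- Apply a function to every argument of an atom. -/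
def Atom.map {S : Schema} {V W : Type} (h : V → W) (f : Atom S V) : Atom S W :=
  ⟨f.rel, fun i => h (f.args i)⟩

/-- An instance (finite or infinite) with values in `V`: a set of facts. -/
abbrev Inst (S : Schema) (V : Type) : Type := Set (Atom S V)

/-- The active domain: the values that occur in some fact. -/
def Inst.adom {S : Schema} {V : Type} (I : Inst S V) : Set V :=
  {v | ∃ f ∈ I, ∃ i, f.args i = v}

/-- The instance obtained by replacing every value `v` by `e v`. -/
def Inst.map {S : Schema} {V W : Type} (e : V → W) (I : Inst S V) : Inst S W :=
  Atom.map e '' I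

theorem Inst.args_mem_adom {S : Schema} {V : Type} {I : Inst S V} {f : Atom S V} (hf : f ∈ I)
    (i : Fin (S.arity f.rel)) : f.args i ∈ I.adom :=
  ⟨f, hf, i, rfl⟩

/-- A homomorphism `I → J`: a function from `adom I` to `adom J` such that the image of every
fact of `I` is a fact of `J`. -/
structure Hom {S : Schema} {V W : Type} (I : Inst S V) (J : Inst S W) where
  toFun : I.adom → J.adom
  map_fact : ∀ (f : Atom S V) (hf : f ∈ I),
    (⟨f.rel, fun i => (toFun ⟨f.args i, Inst.args_mem_adom hf i⟩ : W)⟩ : Atom S W) ∈ J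

/-- A finite instance, bundled with the set its values are taken from. -/
structure FinInst (S : Schema) where
  V : Type
  inst : Inst S V
  finite : inst.Finite

/-- A finite pointed instance with `k` distinguished elements, all in the active domain. -/
structure PointedInst (S : Schema) (k : ℕ) extends FinInst S where
  pts : Fin k → inst.adom

/-- `(I, a) → (J, b)`: there is a homomorphism that maps `a` to `b`. -/
def PointedInst.MapsTo {S : Schema} {k : ℕ} (A B : PointedInst S k) : Prop :=
  ∃ h : Hom A.inst B.inst, ∀ i, h.toFun (A.pts i) = B.pts i

/-! ### Incidence graph and c-acyclicity -/

/-- The vertices of the (subdivided) incidence graph of `I`: the elements of `I`, the facts of `I`,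
and, for each occurrence of an element in a fact (a fact together with an argument position), one
vertex that subdivides the edge of the incidence multigraph that belongs to this occurrence. -/
inductive IncidenceVertex {S : Schema} {V : Type} (I : Inst S V) : Type
  | elem (v : I.adom)
  | fact (f : I)
  | occ (f : I) (i : Fin (S.arity f.1.rel))

/-- The incidence graph of `I`. It is the bipartite multigraph between elements and facts with one
edge for each occurrence of an element in a fact; every edge is subdivided once, which turns the
multigraph into a simple graph with the same cycles (parallel edges yield cycles of length 4). -/
def incidenceGraph {S : Schema} {V : Type} (I : Inst S V) : SimpleGraph (IncidenceVertex I) :=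
  SimpleGraph.fromRel fun p q =>
    ∃ (f : I) (i : Fin (S.arity f.1.rel)), p = .occ f i ∧
      (q = .fact f ∨ q = .elem ⟨f.1.args i, Inst.args_mem_adom f.2 i⟩)

/-- `(I, a)` is c-acyclic: every cycle of the incidence graph contains an element of `a`. -/
def CAcyclic {S : Schema} {V : Type} {k : ℕ} (I : Inst S V) (a : Fin k → I.adom) : Prop :=
  ∀ (p : IncidenceVertex I) (c : (incidenceGraph I).Walk p p), c.IsCycle →
    ∃ i, IncidenceVertex.elem (a i) ∈ c.support

/-! ### Rules (TGDs) -/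

/-- A tuple-generating dependency `∀ x (φ(x) → ∃ z ψ(x, z))`, equivalently an existential Datalog
rule `∃ z ψ(x, z) :- φ(x)`. The variables `x` are indexed by `Fin nUniv` and are precisely the
variables of the body `φ`; the variables `z` are indexed by `Fin nEx` and all occur in the
head `ψ`. -/
structure Rule (S : Schema) where
  nUniv : ℕ
  nEx : ℕ
  body : List (Atom S (Fin nUniv))
  head : List (Atom S (Fin nUniv ⊕ Fin nEx))
  univ_occurs : ∀ x, ∃ f ∈ body, ∃ i, f.args i = x
  ex_occurs : ∀ z, ∃ f ∈ head, ∃ i, f.args i = Sum.inr z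

/-- The rule holds in `J`: whenever the body is satisfied, then so is the head. -/
def Rule.Holds {S : Schema} {V : Type} (r : Rule S) (J : Inst S V) : Prop :=
  ∀ v : Fin r.nUniv → V, (∀ f ∈ r.body, f.map v ∈ J) →
    ∃ w : Fin r.nEx → V, ∀ f ∈ r.head, f.map (Sum.elim v w) ∈ J

/-- `J ⊨ T`, for a set `T` of TGDs. -/
def Models {S : Schema} {V : Type} (J : Inst S V) (T : Set (Rule S)) : Prop :=
  ∀ r ∈ T, r.Holds J

/-! ### Existential Datalog programs -/

/-- The disjoint union of the input, output and auxiliary schema. -/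
def unionSchema (Sin Sout Saux : Schema) : Schema where
  Rel := Sin.Rel ⊕ Sout.Rel ⊕ Saux.Rel
  arity := Sum.elim Sin.arity (Sum.elim Sout.arity Saux.arity)
  finite := by
    have := Sin.finite
    have := Sout.finite
    have := Saux.finite
    infer_instance

def inAtom {Sin Sout Saux : Schema} {V : Type} (f : Atom Sin V) :
    Atom (unionSchema Sin Sout Saux) V :=
  ⟨.inl f.rel, f.args⟩

def outAtom {Sin Sout Saux : Schema} {V : Type} (f : Atom Sout V) :
    Atom (unionSchema Sin Sout Saux) V :=
  ⟨.inr (.inl f.rel), f.args⟩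

def auxAtom {Sin Sout Saux : Schema} {V : Type} (f : Atom Saux V) :
    Atom (unionSchema Sin Sout Saux) V :=
  ⟨.inr (.inr f.rel), f.args⟩

/-- An existential Datalog program: rule bodies use input and auxiliary relations, rule heads use
output and auxiliary relations. -/
structure Program where
  Sin : Schema
  Sout : Schema
  Saux : Schema
  rules : Set (Rule (unionSchema Sin Sout Saux))
  body_rel : ∀ r ∈ rules, ∀ f ∈ r.body, ∀ R : Sout.Rel, f.rel ≠ .inr (.inl R)
  head_rel : ∀ r ∈ rules, ∀ f ∈ r.head, ∀ R : Sin.Rel, f.rel ≠ .inl R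

namespace Program

/-- The schema over which the solutions are instances. -/
abbrev fullSchema (P : Program) : Schema := unionSchema P.Sin P.Sout P.Saux

/-- `J` is a solution for `I`: it contains `I`, and all rules hold in it. -/
def IsSolution (P : Program) {V : Type} (I : Inst P.Sin V) (J : Inst P.fullSchema V) : Prop :=
  (∀ f ∈ I, inAtom f ∈ J) ∧ ∀ r ∈ P.rules, r.Holds J

/-- `J` is a universal solution for `I`: it is a solution, and it has a homomorphism that is the
identity on `adom I` to every solution for `I`. The other solution may use values outside `V`: its
values are taken from a set `W` into which `V` is embedded by `e`. -/
def IsUniversalSolution (P : Program) {V : Type} (I : Inst P.Sin V) (J : Inst P.fullSchema V) :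
    Prop :=
  P.IsSolution I J ∧
    ∀ (W : Type) (e : V ↪ W) (J' : Inst P.fullSchema W), P.IsSolution (I.map e) J' →
      ∃ h : Hom J J', ∀ a : J.adom, (a : V) ∈ I.adom → (h.toFun a : W) = e a

/-- `K` is (a version of) `P(I)`: the output reduct of some universal solution for `I`. -/
def IsOutput (P : Program) {V : Type} (I : Inst P.Sin V) (K : Inst P.Sout V) : Prop :=
  ∃ J : Inst P.fullSchema V, P.IsUniversalSolution I J ∧ K = {f | outAtom f ∈ J}

/-! Weak acyclicity -/

/-- The nodes of the dependency graph: the positions of the auxiliary relations. -/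
abbrev Position (P : Program) : Type := Σ R : P.Saux.Rel, Fin (P.Saux.arity R)

/-- A normal edge of the dependency graph: some variable occurs at the first position in the body
of a rule and at the second position in its head. -/
def NormalEdge (P : Program) (p q : P.Position) : Prop :=
  ∃ r ∈ P.rules, ∃ (s : Fin (P.Saux.arity p.1) → Fin r.nUniv)
    (t : Fin (P.Saux.arity q.1) → Fin r.nUniv ⊕ Fin r.nEx),
    auxAtom ⟨p.1, s⟩ ∈ r.body ∧ auxAtom ⟨q.1, t⟩ ∈ r.head ∧ t q.2 = Sum.inl (s p.2)

/-- A special edge of the dependency graph: the relation of the first position occurs in the body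
of a rule, and its head has an existential variable at the second position. -/
def SpecialEdge (P : Program) (p q : P.Position) : Prop :=
  ∃ r ∈ P.rules, ∃ (s : Fin (P.Saux.arity p.1) → Fin r.nUniv)
    (t : Fin (P.Saux.arity q.1) → Fin r.nUniv ⊕ Fin r.nEx),
    auxAtom ⟨p.1, s⟩ ∈ r.body ∧ auxAtom ⟨q.1, t⟩ ∈ r.head ∧ ∃ z, t q.2 = Sum.inr z

/-- No directed cycle of the dependency graph goes through a special edge. -/
def WeaklyAcyclic (P : Program) : Prop :=
  ¬ ∃ p q : P.Position, P.SpecialEdge p q ∧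
    Relation.ReflTransGen (fun x y => P.NormalEdge x y ∨ P.SpecialEdge x y) q p

/-! Generalized right-adjoints -/

/-- A pair `(J', ι)` of a finite input instance and a partial function from `adom J'` to
`adom J`. -/
structure AdjointPair (P : Program) (J : FinInst P.Sout) where
  target : FinInst P.Sin
  proj : target.inst.adom →. J.inst.adom

/-- The square with sides `h : P(I) → J`, `g : I → J'`, `ι` and the identity on
`adom I ∩ adom P(I)` commutes: on that set, `ι ∘ g` is defined and equal to `h`. -/
def SquareCommutes {P : Program} {J : FinInst P.Sout} (p : P.AdjointPair J) {V : Type}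
    {I : Inst P.Sin V} {K : Inst P.Sout V} (h : Hom K J.inst) (g : Hom I p.target.inst) : Prop :=
  ∀ (a : V) (hI : a ∈ I.adom) (hK : a ∈ K.adom), h.toFun ⟨a, hK⟩ ∈ p.proj (g.toFun ⟨a, hI⟩)

/-- `Ω` is a generalized right-adjoint for `P`: it maps every finite output instance `J` to a finite
set of pairs `(J', ι)` such that, for all (finite or infinite) input instances `I`, every
homomorphism `P(I) → J` has a matching homomorphism `I → J'` for some `(J', ι) ∈ Ω J`, and
conversely, where matching means that the square commutes. -/
def IsGeneralizedRightAdjoint (P : Program)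
    (Ω : (J : FinInst P.Sout) → Set (P.AdjointPair J)) : Prop :=
  ∀ J : FinInst P.Sout, (Ω J).Finite ∧
    ∀ (V : Type) (I : Inst P.Sin V) (K : Inst P.Sout V), P.IsOutput I K →
      (∀ h : Hom K J.inst, ∃ p ∈ Ω J, ∃ g : Hom I p.target.inst, SquareCommutes p h g) ∧
      (∀ p ∈ Ω J, ∀ g : Hom I p.target.inst, ∃ h : Hom K J.inst, SquareCommutes p h g)

def HasGeneralizedRightAdjoint (P : Program) : Prop :=
  ∃ Ω : (J : FinInst P.Sout) → Set (P.AdjointPair J), P.IsGeneralizedRightAdjoint Ω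

end Program

/-! ### The program of a set of TGDs -/

/-- A TGD over `S`, read as a rule over the auxiliary copy of `S`. -/
def auxRule {S : Schema} (r : Rule S) : Rule (unionSchema S S S) where
  nUniv := r.nUniv
  nEx := r.nEx
  body := r.body.map auxAtom
  head := r.head.map auxAtom
  univ_occurs x := by
    obtain ⟨f, hf, i, hi⟩ := r.univ_occurs x
    exact ⟨auxAtom f, List.mem_map_of_mem hf, i, hi⟩
  ex_occurs z := by
    obtain ⟨f, hf, i, hi⟩ := r.ex_occurs z
    exact ⟨auxAtom f, List.mem_map_of_mem hf, i, hi⟩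

/-- The copy rule `R(x) :- R_in(x)`. -/
def copyInRule {S : Schema} (R : S.Rel) : Rule (unionSchema S S S) where
  nUniv := S.arity R
  nEx := 0
  body := [inAtom ⟨R, id⟩]
  head := [auxAtom ⟨R, Sum.inl⟩]
  univ_occurs x := ⟨inAtom ⟨R, id⟩, List.mem_singleton.2 rfl, x, rfl⟩
  ex_occurs z := z.elim0

/-- The copy rule `R_out(x) :- R(x)`. -/
def copyOutRule {S : Schema} (R : S.Rel) : Rule (unionSchema S S S) where
  nUniv := S.arity R
  nEx := 0
  body := [auxAtom ⟨R, id⟩]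
  head := [outAtom ⟨R, Sum.inl⟩]
  univ_occurs x := ⟨auxAtom ⟨R, id⟩, List.mem_singleton.2 rfl, x, rfl⟩
  ex_occurs z := z.elim0

/-- The existential Datalog program of a set `T` of TGDs over `S`: the input, output and auxiliary
schema are three disjoint copies of `S`, and the rules are the TGDs (over the auxiliary copy)
together with the copy rules. -/
def tgdProgram {S : Schema} (T : Set (Rule S)) : Program where
  Sin := S
  Sout := S
  Saux := S
  rules := auxRule '' T ∪ Set.range copyInRule ∪ Set.range copyOutRule
  body_rel := by
    rintro r ((⟨t, -, rfl⟩ | ⟨R, rfl⟩) | ⟨R, rfl⟩) f hf R' h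
    · obtain ⟨g, -, rfl⟩ := List.mem_map.1 hf
      cases h
    · obtain rfl := List.mem_singleton.1 hf
      cases h
    · obtain rfl := List.mem_singleton.1 hf
      cases h
  head_rel := by
    rintro r ((⟨t, -, rfl⟩ | ⟨R, rfl⟩) | ⟨R, rfl⟩) f hf R' h
    · obtain ⟨g, -, rfl⟩ := List.mem_map.1 hf
      cases h
    · obtain rfl := List.mem_singleton.1 hf
      cases h
    · obtain rfl := List.mem_singleton.1 hf
      cases h

/-! ### Homomorphism dualities relative to a set of TGDs -/

/-- `(F, D)` is a homomorphism duality relative to the models of `T`: within the finite pointed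
instances that satisfy `T`, the upward closure of `F` is the complement of the downward closure
of `D`. -/
def IsDualityRel {S : Schema} {k : ℕ} (T : Set (Rule S)) (F D : Set (PointedInst S k)) : Prop :=
  ∀ C : PointedInst S k, Models C.inst T →
    ((∃ A ∈ F, A.MapsTo C) ↔ ¬ ∃ B ∈ D, C.MapsTo B)

/-- `F` has finite duality relative to `T`: it is the left-hand side of a homomorphism duality
whose right-hand side is a finite set of pointed instances that satisfy `T`. -/
def HasFiniteDualityRel {S : Schema} {k : ℕ} (T : Set (Rule S)) (F : Set (PointedInst S k)) :
    Prop :=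
  ∃ D : Set (PointedInst S k), D.Finite ∧ (∀ B ∈ D, Models B.inst T) ∧ IsDualityRel T F D

end HomDuality

/-! Over models C of the TGDs, P(A) → C holds exactly when A → C, because a homomorphism from A into
a model extends to P(A). So F may be replaced by its finitely many c-acyclic sources, and the TGDs
disappear from the left-hand side.

Finite sets of c-acyclic instances have an unconstrained finite duality
(`hasFiniteDualityRel_of_cAcyclic`). Give each element x of C a type: which subinstances of A, with
one marked element, map to C with the mark going to x. There are finitely many types, so the images
of all C under "take types" live on one finite set. If A maps to such an image, then it maps to C,
since c-acyclicity lets partial homomorphisms be glued along facts (`exists_realizes`). The duals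
are the instances on types that receive no member of F.

It remains to turn the duals B into models (`exists_dual_models`). Each pair (J', ι) of the
right-adjoint at B, with a tuple that ι sends to the distinguished elements of B, contributes the
chase of J'. A model C is its own output, so C → B gives C → J', hence C → chase(J'). Conversely J'
→ J' gives chase(J') = P(J') → B. Weak acyclicity makes the chase finite (`finite_chase`). -/

namespace HomDuality

variable {S : Schema} {V W : Type}

/-! ### Partial functions as homomorphisms -/

/-- A function `V → Option W` that is defined on the values of `I` and maps facts of `I` to facts
of `J`. -/
def IsPHom (h : V → Option W) (I : Inst S V) (J : Inst S W) : Prop :=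
  ∀ f ∈ I, ∃ x : Fin (S.arity f.rel) → W, (⟨f.rel, x⟩ : Atom S W) ∈ J ∧
    ∀ j, h (f.args j) = some (x j)

theorem IsPHom.exists_hom {I : Inst S V} {J : Inst S W} {h : V → Option W} (hh : IsPHom h I J) :
    ∃ g : Hom I J, ∀ v : I.adom, h v = some (g.toFun v : W) := by
  have key : ∀ v : I.adom, ∃ w : J.adom, h v = some (w : W) := by
    rintro ⟨_, f, hf, i, rfl⟩
    obtain ⟨x, hx, hj⟩ := hh f hf
    exact ⟨⟨x i, _, hx, i, rfl⟩, hj i⟩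
  choose g hg using key
  refine ⟨⟨g, fun f hf => ?_⟩, hg⟩
  obtain ⟨x, hx, hj⟩ := hh f hf
  have : (fun i => (g ⟨f.args i, Inst.args_mem_adom hf i⟩ : W)) = x := by
    funext i
    exact Option.some_injective _ ((hg ⟨f.args i, Inst.args_mem_adom hf i⟩).symm.trans (hj i))
  rw [this]
  exact hx

theorem Hom.exists_isPHom {I : Inst S V} {J : Inst S W} (g : Hom I J) :
    ∃ h : V → Option W, IsPHom h I J ∧ ∀ v : I.adom, h v = some (g.toFun v : W) := by
  classical
  have key : ∀ v : I.adom, (if hv : (v : V) ∈ I.adom then some (g.toFun ⟨v, hv⟩ : W) else none) =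
      some (g.toFun v : W) := fun v => dif_pos v.2
  exact ⟨fun v => if hv : v ∈ I.adom then some (g.toFun ⟨v, hv⟩ : W) else none,
    fun f hf => ⟨_, g.map_fact f hf, fun j => key ⟨_, Inst.args_mem_adom hf j⟩⟩, key⟩

/-- The homomorphism given by a function on all values. -/
def Hom.ofFun {I : Inst S V} {J : Inst S W} (e : V → W) (he : ∀ f ∈ I, f.map e ∈ J) : Hom I J where
  toFun v := ⟨e v, by
    obtain ⟨_, f, hf, i, rfl⟩ := v
    exact ⟨_, he f hf, i, rfl⟩⟩
  map_fact f hf := he f hf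

/-- Composition of homomorphisms. -/
def Hom.comp {U : Type} {I : Inst S U} {J : Inst S V} {K : Inst S W} (g : Hom J K) (h : Hom I J) :
    Hom I K where
  toFun v := g.toFun (h.toFun v)
  map_fact f hf := g.map_fact _ (h.map_fact f hf)

theorem PointedInst.MapsTo.trans {k : ℕ} {A B C : PointedInst S k} (h : A.MapsTo B)
    (g : B.MapsTo C) : A.MapsTo C := by
  obtain ⟨h, hh⟩ := h
  obtain ⟨g, hg⟩ := g
  exact ⟨g.comp h, fun i => by rw [← hg, ← hh]; rfl⟩

/-! ### Finiteness of sets of facts -/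

theorem finite_atom (S : Schema) (V : Type) [Finite V] : Finite (Atom S V) := by
  have := S.finite
  refine Finite.of_injective
    (fun f : Atom S V => (⟨f.rel, f.args⟩ : Σ R : S.Rel, Fin (S.arity R) → V)) ?_
  rintro ⟨R, x⟩ ⟨R', x'⟩ h
  cases h
  rfl

theorem finite_inst_of_adom {I : Inst S V} {s : Set V} (hs : s.Finite)
    (h : ∀ f ∈ I, ∀ i, f.args i ∈ s) : I.Finite := by
  have := hs.to_subtype
  have := finite_atom S s
  refine (Set.finite_range fun f : Atom S s => f.map Subtype.val).subset fun f hf => ?_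
  exact ⟨⟨f.rel, fun i => ⟨f.args i, h f hf i⟩⟩, rfl⟩

theorem Inst.finite_adom {I : Inst S V} (hI : I.Finite) : I.adom.Finite := by
  have : I.adom = ⋃ f ∈ I, Set.range f.args := by
    ext v
    simp [Inst.adom]
  rw [this]
  exact hI.biUnion fun f _ => Set.finite_range _

/-! ### Solutions and outputs of the program of a set of TGDs -/

/-- The instance over the union of three copies of `S` with the given reducts. -/
def joinInst (I O M : Inst S V) : Inst (unionSchema S S S) V :=
  {f | match f with
    | ⟨.inl R, x⟩ => (⟨R, x⟩ : Atom S V) ∈ I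
    | ⟨.inr (.inl R), x⟩ => (⟨R, x⟩ : Atom S V) ∈ O
    | ⟨.inr (.inr R), x⟩ => (⟨R, x⟩ : Atom S V) ∈ M}

theorem isSolution_joinInst {T : Set (Rule S)} {I I' M : Inst S V} (hI : I ⊆ I') (hM : I' ⊆ M)
    (hT : Models M T) : (tgdProgram T).IsSolution I (joinInst I' M M) := by
  refine ⟨fun f hf => hI hf, ?_⟩
  rintro r ((⟨t, ht, rfl⟩ | ⟨R, rfl⟩) | ⟨R, rfl⟩) v hv
  · obtain ⟨w, hw⟩ := hT t ht v fun f hf => hv (auxAtom f) (List.mem_map_of_mem hf)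
    refine ⟨w, fun f hf => ?_⟩
    obtain ⟨g, hg, rfl⟩ := List.mem_map.1 hf
    exact hw g hg
  · refine ⟨Fin.elim0, fun f hf => ?_⟩
    obtain rfl := List.mem_singleton.1 hf
    exact hM (hv _ (List.mem_singleton.2 rfl))
  · refine ⟨Fin.elim0, fun f hf => ?_⟩
    obtain rfl := List.mem_singleton.1 hf
    exact hv _ (List.mem_singleton.2 rfl)

section Solution

variable {T : Set (Rule S)} {I : Inst S V} {J : Inst (tgdProgram T).fullSchema V}

theorem Program.IsSolution.aux_of_in (h : (tgdProgram T).IsSolution I J) {f : Atom S V}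
    (hf : (inAtom f : Atom (unionSchema S S S) V) ∈ J) :
    (auxAtom f : Atom (unionSchema S S S) V) ∈ J := by
  obtain ⟨w, hw⟩ := h.2 (copyInRule f.rel) (Or.inl (Or.inr ⟨_, rfl⟩)) f.args fun g hg => by
    obtain rfl := List.mem_singleton.1 hg
    exact hf
  exact hw _ (List.mem_singleton.2 rfl)

theorem Program.IsSolution.out_of_aux (h : (tgdProgram T).IsSolution I J) {f : Atom S V}
    (hf : (auxAtom f : Atom (unionSchema S S S) V) ∈ J) :
    (outAtom f : Atom (unionSchema S S S) V) ∈ J := by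
  obtain ⟨w, hw⟩ := h.2 (copyOutRule f.rel) (Or.inr ⟨_, rfl⟩) f.args fun g hg => by
    obtain rfl := List.mem_singleton.1 hg
    exact hf
  exact hw _ (List.mem_singleton.2 rfl)

theorem Program.IsSolution.models_aux (h : (tgdProgram T).IsSolution I J) :
    Models {f : Atom S V | (auxAtom f : Atom (unionSchema S S S) V) ∈ J} T := by
  intro r hr v hv
  obtain ⟨w, hw⟩ := h.2 (auxRule r) (Or.inl (Or.inl ⟨r, hr, rfl⟩)) v fun g hg => by
    obtain ⟨g', hg', rfl⟩ := List.mem_map.1 hg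
    exact hv g' hg'
  exact ⟨w, fun f hf => hw (auxAtom f) (List.mem_map_of_mem hf)⟩

end Solution

/-- Reduces universality over three copies of the schema to universality among models: in any
solution the copy rules carry input facts to the auxiliary part and auxiliary facts to the output
part. -/
theorem isOutput_of_universal {T : Set (Rule S)} {I M : Inst S V} (hIM : I ⊆ M) (hM : Models M T)
    (huniv : ∀ (W : Type) (e : V ↪ W) (N : Inst S W), I.map e ⊆ N → Models N T →
      ∃ φ : V → Option W, IsPHom φ M N ∧ ∀ v ∈ I.adom, φ v = some (e v)) :
    (tgdProgram T).IsOutput I M := by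
  refine ⟨joinInst I M M, ⟨isSolution_joinInst subset_rfl hIM hM, fun W e J' hJ' => ?_⟩, rfl⟩
  have hin : ∀ f ∈ I, (inAtom (f.map e) : Atom (unionSchema S S S) W) ∈ J' :=
    fun f hf => hJ'.1 _ ⟨f, hf, rfl⟩
  obtain ⟨φ, hφ, hφe⟩ := huniv W e {f | (auxAtom f : Atom (unionSchema S S S) W) ∈ J'}
    (by rintro _ ⟨f, hf, rfl⟩; exact hJ'.aux_of_in (hin f hf)) hJ'.models_aux
  have hJ : IsPHom φ (joinInst I M M) J' := by
    rintro ⟨R | R | R, x⟩ hf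
    · exact ⟨_, hin ⟨R, x⟩ hf, fun j => hφe _ (Inst.args_mem_adom (f := ⟨R, x⟩) hf j)⟩
    · obtain ⟨y, hy, hj⟩ := hφ ⟨R, x⟩ hf
      exact ⟨y, hJ'.out_of_aux hy, hj⟩
    · obtain ⟨y, hy, hj⟩ := hφ ⟨R, x⟩ hf
      exact ⟨y, hy, hj⟩
  obtain ⟨g, hg⟩ := hJ.exists_hom
  exact ⟨g, fun a ha => Option.some_injective _ ((hg a).symm.trans (hφe a ha))⟩

theorem isOutput_self {T : Set (Rule S)} {M : Inst S V} (hM : Models M T) :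
    (tgdProgram T).IsOutput M M :=
  isOutput_of_universal subset_rfl hM fun _ e _ hN _ =>
    ⟨fun v => some (e v), fun f hf => ⟨_, hN ⟨f, hf, rfl⟩, fun _ => rfl⟩, fun _ _ => rfl⟩

theorem Program.IsOutput.subset {T : Set (Rule S)} {I K : Inst S V}
    (h : (tgdProgram T).IsOutput I K) : I ⊆ K := by
  obtain ⟨J, hJ, rfl⟩ := h
  exact fun f hf => hJ.1.out_of_aux (hJ.1.aux_of_in (hJ.1.1 f hf))

/-- The preimage of an instance under a partial function. -/
def Inst.comap {U : Type} (π : U → Option W) (N : Inst S W) : Inst S U :=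
  {f | ∃ x : Fin (S.arity f.rel) → W, (⟨f.rel, x⟩ : Atom S W) ∈ N ∧ ∀ j, π (f.args j) = some (x j)}

/-- The preimage of a model under a partial function that has a section is a model. -/
theorem models_comap {U : Type} {T : Set (Rule S)} {N : Inst S W} (hN : Models N T)
    (π : U → Option W) (σ : W → U) (hσ : ∀ w, π (σ w) = some w) :
    Models (N.comap π) T := by
  intro r hr v hv
  have key : ∀ i, ∃ w, π (v i) = some w := by
    intro i
    obtain ⟨f, hf, j, rfl⟩ := r.univ_occurs i
    obtain ⟨x, -, hx⟩ := hv f hf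
    exact ⟨_, hx j⟩
  choose v' hv' using key
  obtain ⟨w, hw⟩ := hN r hr v' fun f hf => by
    obtain ⟨x, hxN, hx⟩ := hv f hf
    have : x = fun j => v' (f.args j) := by
      funext j
      exact Option.some_injective _ ((hx j).symm.trans (hv' _))
    subst this
    exact hxN
  refine ⟨σ ∘ w, fun f hf => ⟨_, hw f hf, fun j => ?_⟩⟩
  change π (Sum.elim v (σ ∘ w) (f.args j)) = some (Sum.elim v' w (f.args j))
  cases f.args j with
  | inl i => exact hv' i
  | inr z => exact hσ _

/-- Universality only speaks of solutions that contain an embedded copy of `I`, while `φ` may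
identify values. So `N` is blown up to its preimage on `V ⊕ W`, which contains `I` injectively, and
the resulting homomorphism is composed with the projection back to `N`. -/
theorem Program.IsOutput.exists_extension {T : Set (Rule S)} {I K : Inst S V}
    (h : (tgdProgram T).IsOutput I K) {N : Inst S W} (hN : Models N T) {φ : V → Option W}
    (hφ : IsPHom φ I N) :
    ∃ ψ : V → Option W, IsPHom ψ K N ∧ ∀ v ∈ I.adom, ψ v = φ v := by
  classical
  obtain ⟨J, hJ, rfl⟩ := h
  let π : V ⊕ W → Option W := Sum.elim φ some
  -- The section `Sum.inr` supplies the existential witnesses.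
  have hM := models_comap hN π Sum.inr fun _ => rfl
  obtain ⟨H, hH⟩ := hJ.2 (V ⊕ W) ⟨Sum.inl, Sum.inl_injective⟩ _
    (isSolution_joinInst (I := I.map Sum.inl)
      (by rintro _ ⟨f, hf, rfl⟩; exact hφ f hf) subset_rfl hM)
  refine ⟨fun v => if hv : v ∈ J.adom then π (H.toFun ⟨v, hv⟩) else none,
    fun f hf => ?_, ?_⟩
  · obtain ⟨x, hx, hj⟩ := H.map_fact (outAtom f) hf
    refine ⟨x, hx, fun j => ?_⟩
    exact (dif_pos (Inst.args_mem_adom (f := outAtom f) hf j)).trans (hj j)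
  · rintro v ⟨f, hf, i, rfl⟩
    have hv : f.args i ∈ J.adom := ⟨inAtom f, hJ.1.1 f hf, i, rfl⟩
    exact (dif_pos hv).trans (congrArg π (hH ⟨_, hv⟩ ⟨f, hf, i, rfl⟩))

end HomDuality

namespace HomDuality

variable {S : Schema} {V W : Type} {k : ℕ}

/-! ### Separation in c-acyclic instances -/

/-- `u` and `v` are connected in `A` by facts other than `f` and by elements outside `K`. -/
def Linked (A : Inst S V) (K : Set V) (f : Atom S V) : V → V → Prop :=
  Relation.ReflTransGen fun u v =>
    u ∉ K ∧ v ∉ K ∧ ∃ g ∈ A, g ≠ f ∧ (∃ i, g.args i = u) ∧ ∃ i, g.args i = v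

theorem Linked.symm {A : Inst S V} {K : Set V} {f : Atom S V} {u v : V} (h : Linked A K f u v) :
    Linked A K f v u := by
  induction h with
  | refl => exact .refl
  | tail _ h ih =>
    obtain ⟨hu, hv, g, hg, hgf, hi, hj⟩ := h
    exact .head ⟨hv, hu, g, hg, hgf, hj, hi⟩ ih

theorem Linked.notMem {A : Inst S V} {K : Set V} {f : Atom S V} {u v : V} (h : Linked A K f u v)
    (hu : u ∉ K) : v ∉ K := by
  cases h with
  | refl => exact hu
  | tail _ h => exact h.2.1

section Incidence

variable {A : Inst S V}

theorem incidenceGraph_adj_fact (f : A) (i : Fin (S.arity f.1.rel)) :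
    (incidenceGraph A).Adj (.occ f i) (.fact f) :=
  (SimpleGraph.fromRel_adj _ _ _).2 ⟨nofun, Or.inl ⟨f, i, rfl, Or.inl rfl⟩⟩

theorem incidenceGraph_adj_elem (f : A) (i : Fin (S.arity f.1.rel)) :
    (incidenceGraph A).Adj (.occ f i) (.elem ⟨f.1.args i, Inst.args_mem_adom f.2 i⟩) :=
  (SimpleGraph.fromRel_adj _ _ _).2 ⟨nofun, Or.inl ⟨f, i, rfl, Or.inr rfl⟩⟩

theorem CAcyclic.isAcyclic {a : Fin k → A.adom} (h : CAcyclic A a) :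
    ((incidenceGraph A).induce {p | ∀ i, p ≠ .elem (a i)}).IsAcyclic := by
  intro p c hc
  obtain ⟨i, hi⟩ := h _ _ (hc.map (f := (SimpleGraph.Embedding.induce _).toHom)
    Subtype.val_injective)
  rw [SimpleGraph.Walk.support_map, List.mem_map] at hi
  obtain ⟨q, -, hq⟩ := hi
  exact q.2 i hq

/-- A link between two argument positions of `f` would close up through `f` to a cycle avoiding `a`.
Formally, the edge between `f` and its occurrence `j` is a bridge once the elements of `a` are
removed, and the link bypasses it. A value repeated in `f` is the case of a trivial link. -/
theorem CAcyclic.not_linked {a : Fin k → A.adom} (h : CAcyclic A a) {f : Atom S V} (hf : f ∈ A)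
    {j j' : Fin (S.arity f.rel)} (hne : j ≠ j') (hj : f.args j ∉ Set.range fun i => (a i : V)) :
    ¬ Linked A (Set.range fun i => (a i : V)) f (f.args j) (f.args j') := by
  intro hl
  set K := Set.range fun i => (a i : V) with hK
  let s : Set (IncidenceVertex A) := {p | ∀ i, p ≠ .elem (a i)}
  let fact (g : A) : s := ⟨.fact g, fun _ => nofun⟩
  let occ (g : A) (i : Fin (S.arity g.1.rel)) : s := ⟨.occ g i, fun _ => nofun⟩
  let elem (v : A.adom) (hv : (v : V) ∉ K) : s := ⟨.elem v, fun i hi => hv ⟨i, by cases hi; rfl⟩⟩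
  let F : A := ⟨f, hf⟩
  let D := ((incidenceGraph A).induce s).deleteEdges {s(occ F j, fact F)}
  have hfact : ∀ g : A, g ≠ F → ∀ i, D.Adj (occ g i) (fact g) := by
    intro g hg i
    refine SimpleGraph.deleteEdges_adj.2 ⟨incidenceGraph_adj_fact g i, fun he => ?_⟩
    rcases Sym2.eq_iff.1 (Set.mem_singleton_iff.1 he) with ⟨-, h2⟩ | ⟨h1, -⟩
    · exact hg (by simpa [fact] using h2)
    · simp [fact, occ] at h1
  have hfact' : D.Adj (occ F j') (fact F) := by
    refine SimpleGraph.deleteEdges_adj.2 ⟨incidenceGraph_adj_fact F j', fun he => ?_⟩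
    rcases Sym2.eq_iff.1 (Set.mem_singleton_iff.1 he) with ⟨h1, -⟩ | ⟨h1, -⟩
    · exact hne (by simpa [occ, eq_comm] using h1)
    · simp [fact, occ] at h1
  have helem : ∀ (g : A) (i) (hi : g.1.args i ∉ K),
      D.Adj (occ g i) (elem ⟨_, Inst.args_mem_adom g.2 i⟩ hi) := by
    intro g i hi
    refine SimpleGraph.deleteEdges_adj.2 ⟨incidenceGraph_adj_elem g i, fun he => ?_⟩
    rcases Sym2.eq_iff.1 (Set.mem_singleton_iff.1 he) with ⟨-, h1⟩ | ⟨h1, -⟩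
    · simp [fact, elem] at h1
    · simp [fact, occ] at h1
  have hreach : ∀ v, Linked A K f (f.args j) v → ∃ (hv : v ∈ A.adom) (hvK : v ∉ K),
      D.Reachable (elem ⟨_, Inst.args_mem_adom hf j⟩ hj) (elem ⟨v, hv⟩ hvK) := by
    intro v hv
    induction hv with
    | refl => exact ⟨_, hj, SimpleGraph.Reachable.refl _⟩
    | tail _ hstep ih =>
      obtain ⟨hu, hv, g, hg, hgf, ⟨i, rfl⟩, ⟨i', rfl⟩⟩ := hstep
      obtain ⟨_, _, ih⟩ := ih
      have hgF : (⟨g, hg⟩ : A) ≠ F := fun h => hgf (congrArg Subtype.val h)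
      exact ⟨Inst.args_mem_adom hg i', hv, ih.trans <|
        (helem ⟨g, hg⟩ i hu).symm.reachable.trans <| (hfact ⟨g, hg⟩ hgF i).reachable.trans <|
        (hfact ⟨g, hg⟩ hgF i').symm.reachable.trans (helem ⟨g, hg⟩ i' hv).reachable⟩
  obtain ⟨_, hj', hr⟩ := hreach _ hl
  have hbridge := SimpleGraph.isAcyclic_iff_forall_adj_isBridge.1 h.isAcyclic
    (v := occ F j) (w := fact F) (incidenceGraph_adj_fact F j)
  exact hbridge ((helem F j hj).reachable.trans <| hr.trans <|
    (helem F j' hj').symm.reachable.trans hfact'.reachable)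

end Incidence

/-! ### Types of elements -/

section Types

variable {A : Inst S V} (a : Fin k → A.adom) (C : Inst S W) (c : Fin k → W)

/-- The function `h` is a homomorphism from `X` to `C` that maps `a` to `c`. -/
def Realizes (X : Inst S V) (h : V → Option W) : Prop :=
  IsPHom h X C ∧ ∀ i, h (a i) = some (c i)

/-- The types of elements relative to the subinstances of `A` with one marked element. -/
abbrev TypeSpace (A : Inst S V) (k : ℕ) : Type :=
  Set (Set.powerset A × A.adom) × Set (Fin k)

/-- The type of an element `x` of `(C, c)`: the subinstances of `A` with a marked element that map
to `C` such that the marked element is mapped to `x`, and the distinguished elements equal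
to `x`. -/
def typeOf (x : W) : TypeSpace A k :=
  ({q | ∃ h, Realizes a C c q.1.1 h ∧ h q.2 = some x}, {i | c i = x})

variable {a C c}

/-- Homomorphisms from the parts of `X` that hang off a fact `f` extend to one from `X`. -/
theorem exists_realizes_of_fact (hac : CAcyclic A a) {X : Inst S V} (hXA : X ⊆ A) {f : Atom S V}
    (hf : f ∈ X) {x : Fin (S.arity f.rel) → W} (hx : (⟨f.rel, x⟩ : Atom S W) ∈ C)
    (hxc : ∀ i j, f.args j = a i → x j = c i)
    (ih : ∀ Y ⊆ X, f ∉ Y →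
      (∃ h, Realizes a C c Y h) ∧ ∀ j, ∃ h, Realizes a C c Y h ∧ h (f.args j) = some (x j)) :
    ∃ h, Realizes a C c X h ∧ ∀ j, h (f.args j) = some (x j) := by
  classical
  set K := Set.range fun i => (a i : V) with hK
  -- The part hanging off position `j`; it is empty if that argument is distinguished. Distinct
  -- parts are disjoint by c-acyclicity, so the maps chosen on them can be glued.
  let B (j : Fin (S.arity f.rel)) : Set V := {v | f.args j ∉ K ∧ Linked A K f (f.args j) v}
  have hBK : ∀ {j v}, v ∈ B j → v ∉ K := fun hv => hv.2.notMem hv.1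
  have huniq : ∀ {j j' v}, v ∈ B j → v ∈ B j' → j = j' := by
    intro j j' v hv hv'
    by_contra hne
    exact hac.not_linked (hXA hf) hne hv.1 (hv.2.trans hv'.2.symm)
  obtain ⟨h₀, hr₀, hc₀⟩ := (ih {g | g ∈ X ∧ g ≠ f ∧ ∀ j i, g.args i ∉ B j}
    (fun g hg => hg.1) fun h => h.2.1 rfl).1
  have hparts : ∀ j, ∃ h, Realizes a C c {g | g ∈ X ∧ g ≠ f ∧ ∃ i, g.args i ∈ B j} h ∧
      h (f.args j) = some (x j) :=
    fun j => (ih _ (fun g hg => hg.1) fun h => h.2.1 rfl).2 j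
  choose p hp hpf using hparts
  let h (v : V) : Option W := if H : ∃ j, v ∈ B j then p H.choose v else h₀ v
  have hB : ∀ {j v}, v ∈ B j → h v = p j v := by
    intro j v hv
    have H : ∃ j, v ∈ B j := ⟨j, hv⟩
    have : H.choose = j := huniq H.choose_spec hv
    simp only [h, dif_pos H, this]
  have hnB : ∀ {v}, (∀ j, v ∉ B j) → h v = h₀ v := by
    intro v hv
    exact dif_neg fun ⟨j, hj⟩ => hv j hj
  have hconst : ∀ i, h (a i) = some (c i) := fun i =>
    (hnB fun j hj => hBK hj ⟨i, rfl⟩).trans (hc₀ i)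
  have hargs : ∀ j, h (f.args j) = some (x j) := by
    intro j
    by_cases hj : f.args j ∈ K
    · obtain ⟨i, hi⟩ := hj
      dsimp only at hi
      rw [← hi, hconst, hxc i j hi.symm]
    · rw [hB (j := j) ⟨hj, Relation.ReflTransGen.refl⟩, hpf]
  refine ⟨h, ⟨fun g hg => ?_, hconst⟩, hargs⟩
  by_cases hgf : g = f
  · subst hgf
    exact ⟨x, hx, hargs⟩
  by_cases hgB : ∃ j i, g.args i ∈ B j
  · obtain ⟨j, i, hi⟩ := hgB
    obtain ⟨y, hy, hyj⟩ := (hp j).1 g ⟨hg, hgf, i, hi⟩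
    refine ⟨y, hy, fun i' => ?_⟩
    -- Every argument of `g` is either distinguished, where all the maps agree, or linked through
    -- `g` to `g.args i` and hence in the same part.
    by_cases hi' : g.args i' ∈ K
    · obtain ⟨l, hl⟩ := hi'
      dsimp only at hl
      rw [← hyj i', ← hl, hconst, (hp j).2]
    · rw [hB (j := j) ⟨hi.1, hi.2.tail ⟨hBK hi, hi', g, hXA hg, hgf, ⟨i, rfl⟩, ⟨i', rfl⟩⟩⟩, hyj]
  · push Not at hgB
    obtain ⟨y, hy, hyj⟩ := hr₀ g ⟨hg, hgf, hgB⟩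
    exact ⟨y, hy, fun i => (hnB fun j => hgB j i).trans (hyj i)⟩

/-- If `A` maps to the quotient of `C` by equality of types, then it maps to `C`. -/
theorem exists_realizes (hA : A.Finite) (hac : CAcyclic A a) (t : A.adom → TypeSpace A k)
    (ht : ∀ i, t (a i) = typeOf a C c (c i))
    (hfact : ∀ (f : Atom S V) (hf : f ∈ A), ∃ x : Fin (S.arity f.rel) → W,
      (⟨f.rel, x⟩ : Atom S W) ∈ C ∧
        ∀ j, t ⟨f.args j, Inst.args_mem_adom hf j⟩ = typeOf a C c (x j)) :
    ∃ h, Realizes a C c A h := by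
  classical
  -- The second component of a type pins down the distinguished elements.
  have hconst : ∀ i x, t (a i) = typeOf a C c x → c i = x := by
    intro i x h
    have hi : i ∈ (typeOf a C c (c i)).2 := rfl
    rw [← ht, h] at hi
    exact hi
  -- The value at one element is prescribed so that parts can be attached to a fact. The element
  -- ranges over all of `A`, since a part need not contain the argument it is attached to.
  suffices H : ∀ n, ∀ X ⊆ A, X.ncard = n → (∃ h, Realizes a C c X h) ∧
      ∀ u x, t u = typeOf a C c x → ∃ h, Realizes a C c X h ∧ h u = some x from
    (H _ A subset_rfl rfl).1
  intro n
  induction n using Nat.strong_induction_on with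
  | _ n IH =>
  intro X hXA hn
  have hstep : ∀ f (hf : f ∈ X), ∃ h, Realizes a C c X h ∧ ∀ j, ∃ x, h (f.args j) = some x ∧
      t ⟨f.args j, Inst.args_mem_adom (hXA hf) j⟩ = typeOf a C c x := by
    intro f hf
    obtain ⟨x, hx, hxt⟩ := hfact f (hXA hf)
    obtain ⟨h, hh, hhj⟩ := exists_realizes_of_fact (c := c) hac hXA hf hx
      (fun i j hij => (hconst i (x j) (by
        rw [← hxt j]; exact congrArg t (Subtype.ext hij.symm))).symm)
      fun Y hY hfY => by
        have hlt : Y.ncard < n := hn ▸ Set.ncard_lt_ncard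
          ⟨hY, fun h => hfY (h hf)⟩ (hA.subset hXA)
        exact ⟨(IH _ hlt Y (hY.trans hXA) rfl).1, fun j =>
          (IH _ hlt Y (hY.trans hXA) rfl).2 ⟨_, Inst.args_mem_adom (hXA hf) j⟩ (x j) (hxt j)⟩
    exact ⟨h, hh, fun j => ⟨x j, hhj j, hxt j⟩⟩
  have hex : ∃ h, Realizes a C c X h := by
    rcases X.eq_empty_or_nonempty with rfl | ⟨f, hf⟩
    · refine ⟨fun v => if H : ∃ i, (a i : V) = v then some (c H.choose) else none,
        fun f hf => hf.elim, fun i => ?_⟩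
      have H : ∃ i', (a i' : V) = a i := ⟨i, rfl⟩
      exact (dif_pos H).trans (congrArg some (hconst H.choose (c i)
        (by rw [← ht i]; exact congrArg t (Subtype.ext H.choose_spec))))
    · obtain ⟨h, hh, -⟩ := hstep f hf
      exact ⟨h, hh⟩
  refine ⟨hex, fun u x hux => ?_⟩
  obtain ⟨h, hh⟩ := hex
  by_cases hu : ∃ i, a i = u
  · obtain ⟨i, rfl⟩ := hu
    exact ⟨h, hh, by rw [hh.2, hconst i x hux]⟩
  by_cases huX : ∃ f ∈ X, ∃ j, f.args j = u
  · obtain ⟨f, hf, j, hj⟩ := huX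
    obtain ⟨h', hh', hj'⟩ := hstep f hf
    obtain ⟨y, hy, hty⟩ := hj' j
    obtain rfl : (⟨f.args j, Inst.args_mem_adom (hXA hf) j⟩ : A.adom) = u := Subtype.ext hj
    -- The types of `y` and `x` agree, so the map of `X` sending the marked element to `y` can be
    -- traded for one sending it to `x`.
    have hmem : ((⟨X, hXA⟩, ⟨f.args j, Inst.args_mem_adom (hXA hf) j⟩) :
        Set.powerset A × A.adom) ∈ (typeOf a C c y).1 := ⟨h', hh', hy⟩
    rw [← hty, hux] at hmem
    exact hmem
  · refine ⟨Function.update h u (some x), ⟨fun f hf => ?_, fun i => ?_⟩, by simp⟩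
    · obtain ⟨y, hy, hj⟩ := hh.1 f hf
      refine ⟨y, hy, fun j => ?_⟩
      rw [Function.update_of_ne fun h => huX ⟨f, hf, j, h⟩, hj]
    · rw [Function.update_of_ne fun h => hu ⟨i, Subtype.ext h⟩, hh.2]

end Types

/-- A finite set of c-acyclic pointed instances has finite duality. -/
theorem hasFiniteDualityRel_of_cAcyclic {F : Set (PointedInst S k)} (hF : F.Finite)
    (hac : ∀ A ∈ F, CAcyclic A.inst A.pts) : HasFiniteDualityRel ∅ F := by
  have := hF.to_subtype
  -- Indexing by `Fin n` keeps `E` in `Type`, so that it can serve as a set of values.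
  obtain ⟨n, ⟨e⟩⟩ := Finite.exists_equiv_fin F
  have hTS (l : Fin n) : Finite (TypeSpace (e.symm l).1.inst k) := by
    have := (e.symm l).1.finite.powerset.to_subtype
    have := (Inst.finite_adom (e.symm l).1.finite).to_subtype
    infer_instance
  let E : Type := ∀ l : Fin n, TypeSpace (e.symm l).1.inst k
  have := finite_atom S E
  let mk (q : Σ I : Inst S E, Fin k → I.adom) : PointedInst S k :=
    ⟨⟨E, q.1, Set.toFinite _⟩, q.2⟩
  refine ⟨{B | B ∈ Set.range mk ∧ ∀ A ∈ F, ¬ A.MapsTo B},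
    (Set.finite_range mk).subset fun B hB => hB.1, fun _ _ => nofun, fun C _ => ⟨?_, ?_⟩⟩
  · rintro ⟨A, hA, hAC⟩ ⟨B, ⟨-, hB⟩, hCB⟩
    exact hB A hA (hAC.trans hCB)
  intro hC
  by_contra hno
  refine hC ?_
  let c (i : Fin k) : C.V := C.pts i
  let τ (x : C.V) : E := fun l => typeOf (e.symm l).1.pts C.inst c x
  let g : Hom C.inst (C.inst.map τ) := Hom.ofFun τ fun f hf => ⟨f, hf, rfl⟩
  refine ⟨mk ⟨C.inst.map τ, fun i => g.toFun (C.pts i)⟩, ⟨⟨_, rfl⟩, ?_⟩, ⟨g, fun _ => rfl⟩⟩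
  rintro A hA ⟨h, hh⟩
  obtain ⟨l, hl⟩ := e.symm.surjective ⟨A, hA⟩
  obtain rfl : (e.symm l).1 = A := congrArg Subtype.val hl
  refine hno ⟨_, hA, ?_⟩
  obtain ⟨φ, hφ, hφc⟩ := exists_realizes (C := C.inst) (c := c) (e.symm l).1.finite (hac _ hA)
    (fun u => (h.toFun u).1 l)
    (fun i => by rw [hh i]; rfl)
    (fun f hf => by
      obtain ⟨⟨R, x⟩, hf', heq⟩ := h.map_fact f hf
      simp only [Atom.map, Atom.mk.injEq] at heq
      obtain ⟨rfl, heq⟩ := heq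
      exact ⟨x, hf', fun j => (congrFun (congrFun (eq_of_heq heq) j) l).symm⟩)
  obtain ⟨g', hg'⟩ := hφ.exists_hom
  exact ⟨g', fun i => Subtype.ext
    (Option.some_injective _ ((hg' _).symm.trans (hφc i)))⟩

end HomDuality

namespace HomDuality

variable {S : Schema} {V W : Type}

/-! ### The oblivious chase -/

/-- The values of the oblivious chase: the given values, and for each rule, each of its existential
variables and each assignment of its universal variables a fresh value. -/
inductive ChaseTerm (T : Set (Rule S)) (V : Type) : Type
  | base (v : V)
  | fresh (r : T) (z : Fin r.1.nEx) (x : Fin r.1.nUniv → ChaseTerm T V)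

namespace ChaseTerm

variable {T : Set (Rule S)}

/-- The values of nesting depth less than `n` that are built from values in `s`. -/
def level (T : Set (Rule S)) (s : Set V) : ℕ → Set (ChaseTerm T V)
  | 0 => ∅
  | n + 1 => base '' s ∪ {t | ∃ r z x, (∀ i, x i ∈ level T s n) ∧ t = fresh r z x}

theorem level_mono {s : Set V} : Monotone (level T s) := by
  refine monotone_nat_of_le_succ fun n => ?_
  induction n with
  | zero => exact Set.empty_subset _
  | succ n ih =>
    exact Set.union_subset_union_right _ fun t ⟨r, z, x, hx, ht⟩ => ⟨r, z, x, fun i => ih (hx i), ht⟩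

theorem finite_level (hT : T.Finite) {s : Set V} (hs : s.Finite) (n : ℕ) :
    (level T s n).Finite := by
  have := hT.to_subtype
  induction n with
  | zero => exact Set.finite_empty
  | succ n ih =>
    have := ih.to_subtype
    refine (hs.image _).union ((Set.finite_range
      fun q : Σ r : T, Fin r.1.nEx × (Fin r.1.nUniv → level T s n) =>
        fresh q.1 q.2.1 fun i => q.2.2 i).subset ?_)
    rintro _ ⟨r, z, x, hx, rfl⟩
    exact ⟨⟨r, z, fun i => ⟨x i, hx i⟩⟩, rfl⟩

end ChaseTerm

/-- The facts derived from `I` by the oblivious chase. -/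
inductive ChaseFact (T : Set (Rule S)) (I : Inst S V) : Atom S (ChaseTerm T V) → Prop
  | base (f : Atom S V) (hf : f ∈ I) : ChaseFact T I (f.map .base)
  | step (r : T) (x : Fin r.1.nUniv → ChaseTerm T V) (hx : ∀ f ∈ r.1.body, ChaseFact T I (f.map x))
      (f : Atom S (Fin r.1.nUniv ⊕ Fin r.1.nEx)) (hf : f ∈ r.1.head) :
      ChaseFact T I (f.map (Sum.elim x fun z => .fresh r z x))

/-- The oblivious chase of `I` with `T`. -/
def chase (T : Set (Rule S)) (I : Inst S V) : Inst S (ChaseTerm T V) :=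
  {f | ChaseFact T I f}

variable {T : Set (Rule S)} {I : Inst S V}

theorem map_base_subset_chase : I.map .base ⊆ chase T I := by
  rintro _ ⟨f, hf, rfl⟩
  exact .base f hf

theorem models_chase : Models (chase T I) T :=
  fun r hr x hx => ⟨fun z => .fresh ⟨r, hr⟩ z x, fun f hf => ChaseFact.step ⟨r, hr⟩ x hx f hf⟩

open Classical in
/-- The evaluation of the values of the chase in a model `N`, given that of the values of `I`. -/
noncomputable def ChaseTerm.eval (hN : Models (T := T) (N : Inst S W)) (e : V → W) :
    ChaseTerm T V → Option W
  | base v => some (e v)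
  | fresh r z x =>
    -- A fresh value goes to the witness chosen in `N`. The default `none` is for terms that no fact
    -- of the chase produces.
    if h : ∃ y : Fin r.1.nUniv → W, (∀ i, (x i).eval hN e = some (y i)) ∧
        ∀ f ∈ r.1.body, f.map y ∈ N then
      some ((hN r.1 r.2 h.choose h.choose_spec.2).choose z)
    else none

theorem isPHom_eval {N : Inst S W} (hN : Models N T) {e : V → W} (he : ∀ f ∈ I, f.map e ∈ N) :
    IsPHom (ChaseTerm.eval hN e) (chase T I) N := by
  intro f hf
  induction hf with
  | base f hf => exact ⟨_, he f hf, fun _ => rfl⟩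
  | step r x hx f hf ih =>
    have hval : ∀ i, ∃ w, (x i).eval hN e = some w := by
      intro i
      obtain ⟨g, hg, j, rfl⟩ := r.1.univ_occurs i
      obtain ⟨y, -, hy⟩ := ih g hg
      exact ⟨_, hy j⟩
    choose y hy using hval
    have hbody : ∀ g ∈ r.1.body, g.map y ∈ N := by
      intro g hg
      obtain ⟨y', hy', hj⟩ := ih g hg
      have : y' = fun j => y (g.args j) := by
        funext j
        exact Option.some_injective _ ((hj j).symm.trans (hy _))
      subst this
      exact hy'
    have h : ∃ y : Fin r.1.nUniv → W, (∀ i, (x i).eval hN e = some (y i)) ∧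
        ∀ f ∈ r.1.body, f.map y ∈ N := ⟨y, hy, hbody⟩
    have hyc : h.choose = y := funext fun i =>
      Option.some_injective _ ((h.choose_spec.1 i).symm.trans (hy i))
    refine ⟨_, (hN r.1 r.2 h.choose h.choose_spec.2).choose_spec f hf, fun j => ?_⟩
    change ChaseTerm.eval hN e (Sum.elim x (fun z => .fresh r z x) (f.args j)) =
      some (Sum.elim h.choose (hN r.1 r.2 h.choose h.choose_spec.2).choose (f.args j))
    cases f.args j with
    | inl i => exact h.choose_spec.1 i
    | inr z =>
      simp only [Sum.elim_inr]
      rw [ChaseTerm.eval, dif_pos h]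

theorem isOutput_chase : (tgdProgram T).IsOutput (I.map .base) (chase T I) := by
  refine isOutput_of_universal map_base_subset_chase models_chase fun W e N hIN hN =>
    ⟨ChaseTerm.eval hN fun v => e (.base v),
      isPHom_eval hN fun f hf => hIN ⟨_, ⟨f, hf, rfl⟩, rfl⟩, ?_⟩
  rintro _ ⟨_, ⟨f, hf, rfl⟩, i, rfl⟩
  rfl

/-! ### Termination of the chase for weakly acyclic sets of TGDs -/

/-- The number of positions from which a special edge followed by a path leads to `p`. -/
noncomputable def Program.rank (P : Program) (p : P.Position) : ℕ :=
  {q | ∃ q', P.SpecialEdge q q' ∧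
    Relation.ReflTransGen (fun x y => P.NormalEdge x y ∨ P.SpecialEdge x y) q' p}.ncard

theorem Program.finite_position (P : Program) : Finite P.Position := by
  have := P.Saux.finite
  infer_instance

theorem Program.rank_le_of_normalEdge {P : Program} {p q : P.Position} (h : P.NormalEdge p q) :
    P.rank p ≤ P.rank q := by
  have := P.finite_position
  exact Set.ncard_le_ncard fun x ⟨x', hx, hp⟩ => ⟨x', hx, hp.tail (Or.inl h)⟩

/-- The position `p` is itself counted at `q`; if it were counted at `p`, a special edge would lie
on a cycle. -/
theorem Program.WeaklyAcyclic.rank_lt {P : Program} (hP : P.WeaklyAcyclic) {p q : P.Position}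
    (h : P.SpecialEdge p q) : P.rank p < P.rank q := by
  have := P.finite_position
  refine Set.ncard_lt_ncard ⟨fun x ⟨x', hx, hp⟩ => ⟨x', hx, hp.tail (Or.inr h)⟩, fun hsub => ?_⟩
  obtain ⟨q', hq', hp⟩ := hsub ⟨q, h, .refl⟩
  exact hP ⟨p, q', hq', hp⟩

/-- Rank bounds nesting depth. A fresh value stores all universal variables of its rule, and special
edges start at every body position, so each stored value comes from a position of smaller rank. The
`+ 1` is there because level 0 is empty. -/
theorem mem_level_of_mem_chase (hwa : (tgdProgram T).WeaklyAcyclic) {f : Atom S (ChaseTerm T V)}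
    (hf : f ∈ chase T I) (j : Fin (S.arity f.rel)) :
    f.args j ∈ ChaseTerm.level T I.adom ((tgdProgram T).rank ⟨f.rel, j⟩ + 1) := by
  induction hf with
  | base f hf => exact Or.inl ⟨_, Inst.args_mem_adom hf j, rfl⟩
  | step r x hx f hf ih =>
    have hr : auxRule r.1 ∈ (tgdProgram T).rules := Or.inl (Or.inl ⟨_, r.2, rfl⟩)
    change Sum.elim x (fun z => ChaseTerm.fresh r z x) (f.args j) ∈
      ChaseTerm.level T I.adom ((tgdProgram T).rank ⟨f.rel, j⟩ + 1)
    cases hj : f.args j with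
    | inl i =>
      obtain ⟨g, hg, l, rfl⟩ := r.1.univ_occurs i
      exact ChaseTerm.level_mono (Nat.succ_le_succ (Program.rank_le_of_normalEdge
        (P := tgdProgram T) (p := ⟨g.rel, l⟩) (q := ⟨f.rel, j⟩)
        ⟨_, hr, g.args, f.args, List.mem_map_of_mem hg, List.mem_map_of_mem hf, hj⟩)) (ih g hg l)
    | inr z =>
      refine Or.inr ⟨r, z, x, fun i => ?_, rfl⟩
      obtain ⟨g, hg, l, rfl⟩ := r.1.univ_occurs i
      exact ChaseTerm.level_mono (hwa.rank_lt (p := ⟨g.rel, l⟩) (q := ⟨f.rel, j⟩)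
        ⟨_, hr, g.args, f.args, List.mem_map_of_mem hg, List.mem_map_of_mem hf, z, hj⟩) (ih g hg l)

theorem finite_chase (hT : T.Finite) (hwa : (tgdProgram T).WeaklyAcyclic) (hI : I.Finite) :
    (chase T I).Finite := by
  have := (tgdProgram T).finite_position
  obtain ⟨n, hn⟩ := (Set.finite_range (tgdProgram T).rank).bddAbove
  exact finite_inst_of_adom (ChaseTerm.finite_level hT (Inst.finite_adom hI) (n + 1))
    fun f hf j => ChaseTerm.level_mono (Nat.succ_le_succ (hn ⟨_, rfl⟩))
      (mem_level_of_mem_chase hwa hf j)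

end HomDuality

/-! ### Transfer of dualities to models of the TGDs -/

namespace HomDuality

variable {S : Schema} {k : ℕ} {T : Set (Rule S)}

/-- For a model `C` of the TGDs, `P(A)` maps to `C` if and only if `A` does. -/
theorem PointedInst.mapsTo_iff_of_isOutput {X C : PointedInst S k} (hC : Models C.inst T)
    {A : Inst S X.V} (hA : A.Finite) {a : Fin k → A.adom} (hout : (tgdProgram T).IsOutput A X.inst)
    (hp : ∀ i, (a i : X.V) = X.pts i) :
    (⟨⟨X.V, A, hA⟩, a⟩ : PointedInst S k).MapsTo C ↔ X.MapsTo C := by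
  constructor
  · rintro ⟨h, hh⟩
    obtain ⟨φ, hφ, hφa⟩ := h.exists_isPHom
    obtain ⟨ψ, hψ, hψa⟩ := hout.exists_extension hC hφ
    obtain ⟨g, hg⟩ := hψ.exists_hom
    refine ⟨g, fun i => Subtype.ext (Option.some_injective _ ?_)⟩
    rw [← hg, ← hp, hψa _ (a i).2, hφa, hh]
  · rintro ⟨h, hh⟩
    refine ⟨h.comp (Hom.ofFun id fun f hf => hout.subset hf), fun i => ?_⟩
    rw [← hh i]
    exact congrArg h.toFun (Subtype.ext (hp i))

/-- A finite duality without constraints yields one relative to a weakly acyclic set of TGDs whose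
program has a generalized right-adjoint. -/
theorem exists_dual_models (hT : T.Finite) (hwa : (tgdProgram T).WeaklyAcyclic)
    (hadj : (tgdProgram T).HasGeneralizedRightAdjoint) {D : Set (PointedInst S k)}
    (hD : D.Finite) :
    ∃ D' : Set (PointedInst S k), D'.Finite ∧ (∀ B ∈ D', Models B.inst T) ∧
      ∀ C : PointedInst S k, Models C.inst T →
        ((∃ B ∈ D, C.MapsTo B) ↔ ∃ B ∈ D', C.MapsTo B) := by
  obtain ⟨Ω, hΩ⟩ := hadj
  let base (J : FinInst S) : Hom J.inst (chase T J.inst) :=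
    Hom.ofFun ChaseTerm.base fun f hf => map_base_subset_chase ⟨f, hf, rfl⟩
  let mk (J : FinInst S) (b : Fin k → J.inst.adom) : PointedInst S k :=
    ⟨⟨_, chase T J.inst, finite_chase hT hwa J.finite⟩, fun i => (base J).toFun (b i)⟩
  refine ⟨⋃ B ∈ D, ⋃ p ∈ Ω B.toFinInst,
    {X | ∃ b, (∀ i, B.pts i ∈ p.proj (b i)) ∧ X = mk p.target b}, ?_, ?_, ?_⟩
  · refine hD.biUnion fun B _ => (hΩ B.toFinInst).1.biUnion fun p _ => ?_
    let J : FinInst S := p.target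
    have : Finite J.inst.adom := (Inst.finite_adom J.finite).to_subtype
    refine (Set.finite_range (mk J)).subset ?_
    rintro _ ⟨b, -, rfl⟩
    exact ⟨b, rfl⟩
  · intro X hX
    simp only [Set.mem_iUnion] at hX
    obtain ⟨B, -, p, -, b, -, rfl⟩ := hX
    exact models_chase
  · intro C hC
    simp only [Set.mem_iUnion]
    constructor
    · rintro ⟨B, hB, h, hh⟩
      obtain ⟨p, hp, g, hg⟩ := ((hΩ B.toFinInst).2 _ _ _ (isOutput_self hC)).1 h
      refine ⟨mk p.target fun i => g.toFun (C.pts i), ⟨B, hB, p, hp, _, fun i => ?_, rfl⟩,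
        (base p.target).comp g, fun i => rfl⟩
      rw [← hh i]
      exact hg _ (C.pts i).2 (C.pts i).2
    · rintro ⟨_, ⟨B, hB, p, hp, b, hb, rfl⟩, hCX⟩
      refine ⟨B, hB, hCX.trans ?_⟩
      let J : FinInst S := p.target
      -- The chase is an output of the copy of `J` on `base` values; removing the tags is the
      -- homomorphism to which the converse half of the adjunction is applied.
      have hinv : ∃ g : Hom (J.inst.map (ChaseTerm.base (T := T))) J.inst,
          ∀ v : J.inst.adom, ∀ hv, g.toFun ⟨.base v, hv⟩ = v := by
        obtain ⟨g, hg⟩ := IsPHom.exists_hom (I := J.inst.map (ChaseTerm.base (T := T)))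
          (J := J.inst) (h := fun t => match t with | .base v => some v | _ => none)
          (by rintro _ ⟨f, hf, rfl⟩; exact ⟨f.args, hf, fun _ => rfl⟩)
        exact ⟨g, fun v hv => Subtype.ext (Option.some_injective _ (hg ⟨.base v, hv⟩).symm)⟩
      obtain ⟨g, hg⟩ := hinv
      obtain ⟨h, hh⟩ := ((hΩ B.toFinInst).2 _ _ _ isOutput_chase).2 p hp g
      refine ⟨h, fun i => ?_⟩
      have hmem : ChaseTerm.base (b i : J.V) ∈ (J.inst.map (ChaseTerm.base (T := T))).adom := by
        obtain ⟨f, hf, j, hj⟩ := (b i).2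
        exact ⟨_, ⟨f, hf, rfl⟩, j, congrArg ChaseTerm.base hj⟩
      -- Both the image of `b i` under `h` and the distinguished element of `B` are values of ι at
      -- `b i`.
      exact Part.mem_unique (Eq.mp (congrArg (fun q => _ ∈ p.proj q) (hg (b i) hmem))
        (hh _ hmem ((base J).toFun (b i)).2)) (hb i)

end HomDuality

theorem mainTheorem8 (S : HomDuality.Schema) (T : Set (HomDuality.Rule S)) (hT : T.Finite)
    (hwa : (HomDuality.tgdProgram T).WeaklyAcyclic)
    (hadj : (HomDuality.tgdProgram T).HasGeneralizedRightAdjoint)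
    (k : ℕ) (F : Set (HomDuality.PointedInst S k)) (hF : F.Finite)
    (hform : ∀ X ∈ F, ∃ (A : HomDuality.Inst S X.V) (a : Fin k → A.adom),
      A.Finite ∧ HomDuality.CAcyclic A a ∧
        (HomDuality.tgdProgram T).IsOutput A X.inst ∧ ∀ i, (a i : X.V) = X.pts i) :
    HomDuality.HasFiniteDualityRel T F := by
  have hsource : ∀ X : F, ∃ A : HomDuality.PointedInst S k, HomDuality.CAcyclic A.inst A.pts ∧
      ∀ C : HomDuality.PointedInst S k, HomDuality.Models C.inst T →
        (A.MapsTo C ↔ X.1.MapsTo C) := by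
    rintro ⟨X, hX⟩
    obtain ⟨A, a, hA, hac, hout, ha⟩ := hform X hX
    exact ⟨⟨⟨X.V, A, hA⟩, a⟩, hac, fun C hC =>
      HomDuality.PointedInst.mapsTo_iff_of_isOutput hC hA hout ha⟩
  choose A hac hA using hsource
  have := hF.to_subtype
  obtain ⟨D₀, hD₀, -, hdual⟩ := HomDuality.hasFiniteDualityRel_of_cAcyclic
    (Set.finite_range A) (by rintro _ ⟨X, rfl⟩; exact hac X)
  obtain ⟨D, hD, hDT, hDD⟩ := HomDuality.exists_dual_models hT hwa hadj hD₀
  refine ⟨D, hD, hDT, fun C hC => ?_⟩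
  rw [← hDD C hC, ← hdual C nofun]
  constructor
  · rintro ⟨X, hX, hXC⟩
    exact ⟨_, ⟨⟨X, hX⟩, rfl⟩, (hA ⟨X, hX⟩ C hC).2 hXC⟩
  · rintro ⟨_, ⟨X, rfl⟩, hXC⟩
    exact ⟨X.1, X.2, (hA X C hC).1 hXC⟩
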